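/- Consider a parametrized family of functions $f_\theta:\mathbb R^p\to\mathbb R$, $\theta=(w,b)\in\mathbb R^n$ (a neural network of any architecture with $n$ parameters), and a data set $(x_1,y_1),\dots,(x_d,y_d)$ with $x_i\in\mathbb R^p$, $y_i\in\mathbb R$ and $n>d$. Assume that each residual $f_i(\theta)=f_\theta(x_i)-y_i$ is a $C^\infty$ function of $\theta\in\mathbb R^n$. For $\tilde y\in\mathbb R^d$ let $$L_{\tilde y}(\theta)=\sum_{i=1}^d\bigl(f_\theta(x_i)-\tilde y_i\bigr)^2$$ be the squared loss for the data set with labels $\tilde y_i$. Then for every $\varepsilon>0$ there is $\tilde y\in\mathbb R^d$ with Euclidean distance $|\tilde y-y|<\varepsilon$ such that the zero locus $M=L_{\tilde y}^{-1}(0)$ is a (possibly empty) smooth embedded submanifold of $\mathbb R^n$ of dimension $n-d$. -/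

import Mathlib

open scoped ContDiff

/-- The residual `f_i(θ) = f_θ(x_i) - y_i` of the network `f` at the `i`-th data point, as a
function of the parameter vector `θ ∈ ℝⁿ` (all weights and biases). A network of arbitrary
architecture is the parametrized family `θ ↦ f_θ` of functions `ℝᵖ → ℝ` that it computes. -/
def dataResidual {n p d : ℕ} (f : EuclideanSpace ℝ (Fin n) → EuclideanSpace ℝ (Fin p) → ℝ)
    (x : Fin d → EuclideanSpace ℝ (Fin p)) (y : EuclideanSpace ℝ (Fin d)) (i : Fin d)
    (θ : EuclideanSpace ℝ (Fin n)) : ℝ :=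
  f θ (x i) - y i

/-- The squared loss `L(θ) = ∑ᵢ (f_θ(x_i) - y_i)²`. -/
def squaredLoss {n p d : ℕ} (f : EuclideanSpace ℝ (Fin n) → EuclideanSpace ℝ (Fin p) → ℝ)
    (x : Fin d → EuclideanSpace ℝ (Fin p)) (y : EuclideanSpace ℝ (Fin d))
    (θ : EuclideanSpace ℝ (Fin n)) : ℝ :=
  ∑ i, dataResidual f x y i θ ^ 2

/-- `M ⊆ ℝⁿ` is a (possibly empty) smooth embedded submanifold of dimension `k`: around each of
its points there is a smooth chart `Φ` of `ℝⁿ` (a `C^∞` diffeomorphism between open subsets of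
`ℝⁿ`) that carries `M` to the slice `ℝᵏ × {0}`, that is, a point of the domain of `Φ` lies in `M`
if and only if all but the first `k` coordinates of its image vanish. -/
def IsSmoothSubmanifold {n : ℕ} (k : ℕ) (M : Set (EuclideanSpace ℝ (Fin n))) : Prop :=
  ∀ m ∈ M, k ≤ n ∧
    ∃ Φ : OpenPartialHomeomorph (EuclideanSpace ℝ (Fin n)) (EuclideanSpace ℝ (Fin n)),
      m ∈ Φ.source ∧
      ContDiffOn ℝ ∞ Φ Φ.source ∧
      ContDiffOn ℝ ∞ Φ.symm Φ.target ∧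
      ∀ θ ∈ Φ.source, θ ∈ M ↔ ∀ j : Fin n, k ≤ (j : ℕ) → Φ θ j = 0

/-!
Write `F_i θ = f_θ(x_i)`. The zero locus of the loss with labels `y'` is the fibre over `y'` of
`F = (F_1, …, F_d) : ℝⁿ → ℝᵈ`. If `y'` is a regular value of `F`, the inverse function theorem
straightens `F` near each point of the fibre to a coordinate projection
(`exists_chart_of_submersion`), which is the submanifold chart required. It remains to find regular
values arbitrarily close to `y`.

For this, Sard's theorem is needed only for real-valued functions, since the coordinates of `y'`
can be chosen one at a time (`exists_regular_value_near`): given a regular value of some of the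
`F_i`, their fibre is locally parametrized by a Euclidean space, and the next coordinate only has to
avoid the critical values of the next `F_i` in these parametrizations.

Sard's theorem for `f : ℝᵐ → ℝ` (`scalarSard`) goes by induction on `m`. Where all derivatives of
orders `1, …, m` vanish, Taylor's estimate makes `f` Hölder of exponent `m + 1`, so the image has
Hausdorff dimension at most `m / (m + 1) < 1` and is null (`volume_image_flat_eq_zero`). At any other
critical point, some derivative of order `k ≥ 1` vanishes while one of its partial derivatives does
not. Such points lie locally on a smooth hypersurface, and restricting `f` to it reduces the
dimension (`ScalarSard.volume_image_levelSet`).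
-/

open MeasureTheory Set Topology Module

/-! ### Straightening a submersion -/

section Straightening

variable {E G H : Type*} [NormedAddCommGroup E] [NormedSpace ℝ E] [FiniteDimensional ℝ E]
  [NormedAddCommGroup G] [NormedSpace ℝ G] [FiniteDimensional ℝ G]
  [NormedAddCommGroup H] [NormedSpace ℝ H] [FiniteDimensional ℝ H]

/-- The second component `P` maps the kernel of `A` isomorphically onto `H`. -/
lemma exists_continuousLinearEquiv_prod_of_surjective (A : E →L[ℝ] G)
    (hA : Function.Surjective A) (hdim : finrank ℝ G + finrank ℝ H = finrank ℝ E) :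
    ∃ (P : E →L[ℝ] H) (e : E ≃L[ℝ] G × H), (e : E →L[ℝ] G × H) = A.prod P := by
  have hker : finrank ℝ (LinearMap.ker A.toLinearMap) = finrank ℝ H := by
    have h1 := LinearMap.finrank_range_add_finrank_ker A.toLinearMap
    rw [LinearMap.range_eq_top.2 hA, finrank_top] at h1
    omega
  obtain ⟨Q, hQ⟩ := LinearMap.exists_leftInverse_of_injective
    (LinearMap.ker A.toLinearMap).subtype (Submodule.ker_subtype _)
  let i := LinearEquiv.ofFinrankEq _ _ hker
  let P : E →ₗ[ℝ] H := i.toLinearMap ∘ₗ Q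
  have hinj : Function.Injective (A.toLinearMap.prod P) := by
    rw [← LinearMap.ker_eq_bot, LinearMap.ker_eq_bot']
    intro v hv
    have hAv : v ∈ LinearMap.ker A.toLinearMap := congrArg Prod.fst hv
    have hPv : i (Q v) = 0 := congrArg Prod.snd hv
    have hQv : Q v = 0 := by simpa using hPv
    have h2 : Q v = ⟨v, hAv⟩ := LinearMap.congr_fun hQ ⟨v, hAv⟩
    rw [hQv] at h2
    exact (congrArg Subtype.val h2).symm
  refine ⟨P.toContinuousLinearMap, (LinearMap.linearEquivOfInjective _ hinj
    (by rw [finrank_prod, hdim])).toContinuousLinearEquiv, ?_⟩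
  ext v <;> rfl

/-- Smooth form of the implicit function theorem: near a point where `dg` is onto, `g` is the first
component of a `C^∞` diffeomorphism between open subsets of `E` and `G × H`. -/
lemma exists_chart_of_submersion {U : Set E} (hU : IsOpen U) {g : E → G}
    (hg : ∀ x ∈ U, ContDiffAt ℝ ∞ g x) {a : E} (ha : a ∈ U)
    (hsurj : Function.Surjective (fderiv ℝ g a))
    (hdim : finrank ℝ G + finrank ℝ H = finrank ℝ E) :
    ∃ Φ : OpenPartialHomeomorph E (G × H), a ∈ Φ.source ∧ Φ.source ⊆ U ∧
      (∀ x, (Φ x).1 = g x) ∧ ContDiffOn ℝ ∞ Φ Φ.source ∧ ContDiffOn ℝ ∞ Φ.symm Φ.target := by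
  obtain ⟨P, e, he⟩ := exists_continuousLinearEquiv_prod_of_surjective (H := H) _ hsurj hdim
  let h : E → G × H := fun x => (g x, P x)
  have hh : ∀ x ∈ U, ContDiffAt ℝ ∞ h x := fun x hx => (hg x hx).prodMk P.contDiff.contDiffAt
  have hda : HasFDerivAt h (e : E →L[ℝ] G × H) a := by
    rw [he]
    exact ((hg a ha).differentiableAt (by simp)).hasFDerivAt.prodMk P.hasFDerivAt
  -- The derivative stays invertible on a neighbourhood, which makes the inverse `C^∞` there.
  have hev : ∀ᶠ x in 𝓝 a, x ∈ U ∧ fderiv ℝ h x ∈ range ((↑) : (E ≃L[ℝ] G × H) → E →L[ℝ] G × H) := by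
    refine Filter.Eventually.and (hU.mem_nhds ha) ?_
    have hc : ContinuousAt (fderiv ℝ h) a :=
      ((hh a ha).fderiv_right (m := 0) (by simp)).continuousAt
    refine hc.eventually_mem ?_
    rw [hda.fderiv]
    exact ContinuousLinearEquiv.nhds e
  obtain ⟨V, hV, hVo, haV⟩ := eventually_nhds_iff.1 hev
  let Ψ := (hh a ha).toOpenPartialHomeomorph h hda (by simp)
  let Φ := Ψ.restrOpen V hVo
  have hΦs : Φ.source ⊆ V := fun x hx => hx.2
  refine ⟨Φ, ⟨(hh a ha).mem_toOpenPartialHomeomorph_source hda (by simp), haV⟩,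
    fun x hx => (hV x (hΦs hx)).1, fun x => rfl,
    fun x hx => (hh x (hV x (hΦs hx)).1).contDiffWithinAt, fun z hz => ?_⟩
  have hs := Φ.map_target hz
  obtain ⟨hxU, e', he'⟩ := hV _ (hΦs hs)
  refine (Φ.contDiffAt_symm (f₀' := e') hz ?_ (hh _ hxU)).contDiffWithinAt
  rw [he']
  exact ((hh _ hxU).differentiableAt (by simp)).hasFDerivAt

end Straightening

/-! ### Sard's theorem for real-valued functions -/

section Sard

variable {E : Type*} [NormedAddCommGroup E] [NormedSpace ℝ E] [FiniteDimensional ℝ E]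

lemma measure_image_eq_zero_of_locally {X Y : Type*} [TopologicalSpace X]
    [SecondCountableTopology X] [MeasurableSpace Y] {μ : Measure Y} {f : X → Y} {s : Set X}
    (h : ∀ x ∈ s, ∃ u ∈ 𝓝 x, μ (f '' (s ∩ u)) = 0) : μ (f '' s) = 0 := by
  choose! u hu hμ using h
  obtain ⟨t, hts, htc, hcov⟩ := TopologicalSpace.countable_cover_nhdsWithin
    (fun x hx => mem_nhdsWithin_of_mem_nhds (hu x hx))
  refine measure_mono_null (t := ⋃ x ∈ t, f '' (s ∩ u x)) ?_
    ((measure_biUnion_null_iff htc).2 fun x hx => hμ x (hts hx))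
  rintro _ ⟨y, hy, rfl⟩
  obtain ⟨x, hx, hyx⟩ := mem_iUnion₂.1 (hcov hy)
  exact mem_iUnion₂.2 ⟨x, hx, y, ⟨hy, hyx⟩, rfl⟩

omit [FiniteDimensional ℝ E] in
/-- Taylor's estimate at a point where the derivatives of orders `1, …, N` vanish. By the mean value
inequality, a bound of order `j` in `‖y - x‖` for the derivative of order `k + 1` gives one of
order `j + 1` for the derivative of order `k`. -/
lemma norm_sub_le_pow_of_iteratedFDeriv_eq_zero {F : Type*} [NormedAddCommGroup F]
    [NormedSpace ℝ F] {f : E → F} {B : Set E} (hB : Convex ℝ B)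
    (hf : ∀ z ∈ B, ContDiffAt ℝ ∞ f z) {N : ℕ} {C : ℝ}
    (hC : ∀ z ∈ B, ‖iteratedFDeriv ℝ (N + 1) f z‖ ≤ C) {x : E} (hx : x ∈ B)
    (h0 : ∀ k, 1 ≤ k → k ≤ N → iteratedFDeriv ℝ k f x = 0) {y : E} (hy : y ∈ B) :
    ‖f y - f x‖ ≤ C * ‖y - x‖ ^ (N + 1) := by
  have hC0 : 0 ≤ C := (norm_nonneg _).trans (hC x hx)
  have hconv : ∀ y : E, Convex ℝ (B ∩ Metric.closedBall x ‖y - x‖) := fun y =>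
    hB.inter (convex_closedBall _ _)
  have hbd : ∀ y z : E, z ∈ B ∩ Metric.closedBall x ‖y - x‖ → ‖z - x‖ ≤ ‖y - x‖ :=
    fun y z hz => by simpa [dist_eq_norm] using hz.2
  have key : ∀ j k, k + j = N + 1 → 1 ≤ k → ∀ y ∈ B,
      ‖iteratedFDeriv ℝ k f y‖ ≤ C * ‖y - x‖ ^ j := by
    intro j
    induction j with
    | zero =>
      intro k hk _ y hy
      obtain rfl : k = N + 1 := by omega
      simpa using hC y hy
    | succ j ih =>
      intro k hk hk1 y hy
      have := (hconv y).norm_image_sub_le_of_norm_fderiv_le (𝕜 := ℝ)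
        (f := iteratedFDeriv ℝ k f) (C := C * ‖y - x‖ ^ j) (x := x) (y := y)
        (fun z hz => ((hf z hz.1).iteratedFDeriv_right (m := 1) (i := k)
          (by exact_mod_cast le_top)).differentiableAt (by simp))
        (fun z hz => by
          rw [norm_fderiv_iteratedFDeriv]
          refine (ih (k + 1) (by omega) (by omega) z hz.1).trans ?_
          gcongr
          exact hbd y z hz)
        ⟨hx, by simp⟩ ⟨hy, by simp [dist_eq_norm]⟩
      rw [h0 k hk1 (by omega), sub_zero] at this
      rwa [pow_succ, ← mul_assoc]
  have := (hconv y).norm_image_sub_le_of_norm_fderiv_le (𝕜 := ℝ)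
    (f := f) (C := C * ‖y - x‖ ^ N) (x := x) (y := y)
    (fun z hz => (hf z hz.1).differentiableAt (by simp))
    (fun z hz => by
      rw [← norm_iteratedFDeriv_one]
      refine (key N 1 (by omega) le_rfl z hz.1).trans ?_
      gcongr
      exact hbd y z hz)
    ⟨hx, by simp⟩ ⟨hy, by simp [dist_eq_norm]⟩
  rwa [pow_succ, ← mul_assoc]

/-- The image of the flat points is null: `f` restricted to them is locally Hölder of exponent
`N + 1 > dim E`, so the image has Hausdorff dimension less than `1`. -/
lemma volume_image_flat_eq_zero {U : Set E} (hU : IsOpen U) {f : E → ℝ}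
    (hf : ∀ x ∈ U, ContDiffAt ℝ ∞ f x) {N : ℕ} (hN : finrank ℝ E ≤ N) :
    volume (f '' {x ∈ U | ∀ k, 1 ≤ k → k ≤ N → iteratedFDeriv ℝ k f x = 0}) = 0 := by
  refine measure_image_eq_zero_of_locally fun a ha => ?_
  have hc : ContinuousAt (iteratedFDeriv ℝ (N + 1) f) a :=
    (hf a ha.1).continuousAt_iteratedFDeriv (by exact_mod_cast le_top)
  obtain ⟨r, hr, hball⟩ := Metric.eventually_nhds_iff_ball.1
    (Filter.Eventually.and (hU.mem_nhds ha.1)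
      (hc.norm.eventually_le_const (lt_add_one ‖iteratedFDeriv ℝ (N + 1) f a‖)))
  refine ⟨Metric.ball a r, Metric.ball_mem_nhds a hr, ?_⟩
  set C : NNReal := ⟨‖iteratedFDeriv ℝ (N + 1) f a‖ + 1, by positivity⟩
  set S := {x ∈ U | ∀ k, 1 ≤ k → k ≤ N → iteratedFDeriv ℝ k f x = 0}
  have hol : HolderOnWith C (N + 1 : ℕ) f (S ∩ Metric.ball a r) := by
    intro x hx y hy
    have := norm_sub_le_pow_of_iteratedFDeriv_eq_zero (convex_ball a r)
      (fun z hz => hf z (hball z hz).1) (C := C) (fun z hz => (hball z hz).2) hy.2 hy.1.2 hx.2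
    rw [NNReal.coe_natCast, ENNReal.rpow_natCast, edist_eq_enorm_sub, edist_eq_enorm_sub]
    change (‖f x - f y‖₊ : ENNReal) ≤ C * (‖x - y‖₊ : ENNReal) ^ (N + 1)
    exact_mod_cast this
  have hdim : dimH (f '' (S ∩ Metric.ball a r)) < (1 : NNReal) := by
    refine (hol.dimH_image_le (by positivity)).trans_lt ?_
    have h1 : dimH (S ∩ Metric.ball a r) ≤ finrank ℝ E :=
      (dimH_mono (subset_univ _)).trans_eq (Real.dimH_univ_eq_finrank E)
    rw [ENNReal.div_lt_iff (by simp) (by simp)]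
    refine h1.trans_lt ?_
    simp only [ENNReal.coe_one, one_mul, ENNReal.coe_natCast]
    exact_mod_cast Nat.lt_succ_of_le hN
  simpa [hausdorffMeasure_real] using hausdorffMeasure_of_dimH_lt hdim

/-- Sard's theorem for real-valued functions in dimension `m`: the critical values of a `C^∞`
function on an open subset of `ℝᵐ` form a Lebesgue null set. A smooth function on `U` is encoded as
a function on all of `ℝᵐ` that is `C^∞` at every point of `U`. -/
def ScalarSard (m : ℕ) : Prop :=
  ∀ (U : Set (EuclideanSpace ℝ (Fin m))) (f : EuclideanSpace ℝ (Fin m) → ℝ), IsOpen U →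
    (∀ x ∈ U, ContDiffAt ℝ ∞ f x) → volume (f '' {x ∈ U | fderiv ℝ f x = 0}) = 0

/-- Sard's theorem in dimension `m` for the restriction of `f` to the regular part of the level set
`g = 0`, which has dimension `m`: the critical points of the restriction are the points where `df`
vanishes on the kernel of `dg`. -/
lemma ScalarSard.volume_image_levelSet {m : ℕ} (hm : ScalarSard m) {G : Type*}
    [NormedAddCommGroup G] [NormedSpace ℝ G] [FiniteDimensional ℝ G]
    (hdim : finrank ℝ G + m = finrank ℝ E) {U : Set E} (hU : IsOpen U) {f : E → ℝ} {g : E → G}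
    (hf : ∀ x ∈ U, ContDiffAt ℝ ∞ f x) (hg : ∀ x ∈ U, ContDiffAt ℝ ∞ g x) :
    volume (f '' {x ∈ U | g x = 0 ∧ Function.Surjective (fderiv ℝ g x) ∧
      ∀ v, fderiv ℝ g x v = 0 → fderiv ℝ f x v = 0}) = 0 := by
  refine measure_image_eq_zero_of_locally fun a ha => ?_
  obtain ⟨haU, -, hsurj, -⟩ := ha
  obtain ⟨Φ, haΦ, hΦU, hΦg, -, hΦs⟩ := exists_chart_of_submersion
    (H := EuclideanSpace ℝ (Fin m)) hU hg haU hsurj (by simpa using hdim)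
  refine ⟨Φ.source, Φ.open_source.mem_nhds haΦ, ?_⟩
  -- `ψ` parametrizes the level set `g = 0` inside the domain of the chart.
  let ψ : EuclideanSpace ℝ (Fin m) → E := fun z => Φ.symm (0, z)
  let W : Set (EuclideanSpace ℝ (Fin m)) := {z | ((0 : G), z) ∈ Φ.target}
  have hW : IsOpen W := Φ.open_target.preimage (by fun_prop)
  have hψ : ∀ z ∈ W, ContDiffAt ℝ ∞ ψ z := fun z hz =>
    ContDiffAt.comp z (hΦs.contDiffAt (Φ.open_target.mem_nhds hz))
      (contDiff_const.prodMk contDiff_id).contDiffAt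
  have hψU : ∀ z ∈ W, ψ z ∈ U := fun z hz => hΦU (Φ.map_target hz)
  have hgψ : ∀ z ∈ W, g (ψ z) = 0 := fun z hz => by
    rw [← hΦg, show Φ (ψ z) = (0, z) from Φ.right_inv hz]
  refine measure_mono_null ?_ (hm W (f ∘ ψ) hW fun z hz => (hf _ (hψU z hz)).comp z (hψ z hz))
  rintro _ ⟨x, ⟨⟨hxU, hgx, -, hx⟩, hxs⟩, rfl⟩
  have hΦx : Φ x = (0, (Φ x).2) := Prod.ext ((hΦg x).trans hgx) rfl
  have hzW : (Φ x).2 ∈ W := by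
    change (0, (Φ x).2) ∈ Φ.target
    rw [← hΦx]
    exact Φ.map_source hxs
  have hψx : ψ (Φ x).2 = x := by
    change Φ.symm (0, (Φ x).2) = x
    rw [← hΦx, Φ.left_inv hxs]
  refine ⟨(Φ x).2, ⟨hzW, ?_⟩, congrArg f hψx⟩
  have hψd := (hψ _ hzW).differentiableAt (by simp)
  have hfd : DifferentiableAt ℝ f (ψ (Φ x).2) := by
    rw [hψx]; exact (hf x hxU).differentiableAt (by simp)
  have hgd : DifferentiableAt ℝ g (ψ (Φ x).2) := by
    rw [hψx]; exact (hg x hxU).differentiableAt (by simp)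
  have h0 : fderiv ℝ (g ∘ ψ) (Φ x).2 = 0 := by
    have : g ∘ ψ =ᶠ[𝓝 (Φ x).2] fun _ => 0 :=
      Filter.eventually_of_mem (hW.mem_nhds hzW) hgψ
    rw [this.fderiv_eq, fderiv_const_apply]
  rw [fderiv_comp _ hgd hψd, hψx] at h0
  rw [fderiv_comp _ hfd hψd, hψx]
  ext w
  exact hx _ (DFunLike.congr_fun h0 w)

lemma scalarSard (m : ℕ) : ScalarSard m := by
  induction m with
  | zero =>
    intro U f _ _
    exact (Set.subsingleton_of_subsingleton.image f).measure_zero _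
  | succ m ih =>
    intro U f hU hf
    let E := EuclideanSpace ℝ (Fin (m + 1))
    -- The critical points where the `k`-th derivative vanishes but the next one does not.
    let Z : ℕ → Set E := fun k => {x ∈ U | fderiv ℝ f x = 0 ∧ iteratedFDeriv ℝ k f x = 0 ∧
      iteratedFDeriv ℝ (k + 1) f x ≠ 0}
    -- `Z k` lies locally in a level set of a scalar component `g` of the `k`-th derivative, at whose
    -- points `dg ≠ 0`.
    have hZ : ∀ k, 1 ≤ k → volume (f '' Z k) = 0 := by
      intro k hk
      refine measure_image_eq_zero_of_locally fun a ha => ?_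
      obtain ⟨haU, -, -, hak⟩ := ha
      obtain ⟨w, hw⟩ : ∃ w, iteratedFDeriv ℝ (k + 1) f a w ≠ 0 := by
        by_contra! h
        exact hak (ContinuousMultilinearMap.ext h)
      let g : E → ℝ := fun x => iteratedFDeriv ℝ k f x (Fin.tail w)
      let ev := ContinuousMultilinearMap.apply ℝ (fun _ : Fin k => E) ℝ (Fin.tail w)
      have hD : ∀ x ∈ U, ContDiffAt ℝ ∞ (iteratedFDeriv ℝ k f) x := fun x hx =>
        (hf x hx).iteratedFDeriv_right (by exact_mod_cast le_top)
      have hg : ∀ x ∈ U, ContDiffAt ℝ ∞ g x := fun x hx =>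
        ev.contDiff.contDiffAt.comp x (hD x hx)
      have hga : fderiv ℝ g a ≠ 0 := by
        intro h
        have hfd := ev.hasFDerivAt.comp a ((hD a haU).differentiableAt (by simp)).hasFDerivAt
        refine hw ?_
        rw [iteratedFDeriv_succ_apply_left]
        exact DFunLike.congr_fun (hfd.fderiv.symm.trans h) (w 0)
      have hc : ContinuousAt (fderiv ℝ g) a :=
        ((hg a haU).fderiv_right (m := 0) (by simp)).continuousAt
      refine ⟨_, hc.eventually_ne hga, measure_mono_null (image_mono ?_)
        (ih.volume_image_levelSet (by simp [add_comm]) hU hf hg)⟩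
      rintro x ⟨⟨hxU, hx, hxk, -⟩, hgx⟩
      refine ⟨hxU, by simp [g, hxk], ?_, fun v _ => by simp [hx]⟩
      exact LinearMap.surjective (f := (fderiv ℝ g x).toLinearMap)
        fun h => hgx (ContinuousLinearMap.coe_injective h)
    refine measure_mono_null ?_ (measure_union_null
      (volume_image_flat_eq_zero hU hf (N := m + 1) (by simp))
      (measure_iUnion_null fun k => measure_iUnion_null fun hk : 1 ≤ k => hZ k hk))
    rintro _ ⟨x, ⟨hxU, hx⟩, rfl⟩
    have h1 : iteratedFDeriv ℝ 1 f x = 0 := by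
      rw [← norm_eq_zero, norm_iteratedFDeriv_one, hx, norm_zero]
    by_cases hall : ∀ k, 1 ≤ k → k ≤ m + 1 → iteratedFDeriv ℝ k f x = 0
    · exact Or.inl ⟨x, ⟨hxU, hall⟩, rfl⟩
    · right
      by_contra hcon
      refine hall fun k hk _ => ?_
      induction k, hk using Nat.le_induction with
      | base => exact h1
      | succ k hk ihk =>
        by_contra hne
        exact hcon (mem_iUnion₂.2 ⟨k, hk, x, ⟨hxU, hx, ihk (by omega), hne⟩, rfl⟩)

end Sard

/-! ### Regular values and their fibres -/

section RegularValues

lemma hasFDerivAt_pi_sub_const {E : Type*} [NormedAddCommGroup E] [NormedSpace ℝ E] {d : ℕ}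
    {F : Fin d → E → ℝ} (hF : ∀ i, ContDiff ℝ ∞ (F i)) (c : Fin d → ℝ) (x : E) :
    HasFDerivAt (fun x i => F i x - c i)
      (ContinuousLinearMap.pi fun i => fderiv ℝ (F i) x) x :=
  hasFDerivAt_pi.2 fun i =>
    (((hF i).differentiable (by simp)).differentiableAt.hasFDerivAt).sub_const _

/-- A weak form of Sard's theorem for maps into `ℝᵈ`: regular values of `(F₁, …, F_d)` are dense.
The coordinates of the value are chosen one after another. Once the value `z` of the other
functions is regular, the critical values of the remaining one on the level set of `z` are null by
`ScalarSard.volume_image_levelSet`, so a noncritical `t` exists within `ε`; at a point of the joint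
level set its derivative is nonzero on the common kernel of the others, which makes the joint
derivative onto. -/
lemma exists_regular_value_near {E : Type*} [NormedAddCommGroup E] [NormedSpace ℝ E]
    [FiniteDimensional ℝ E] {d : ℕ} (hd : d ≤ finrank ℝ E) {F : Fin d → E → ℝ}
    (hF : ∀ i, ContDiff ℝ ∞ (F i)) (y : Fin d → ℝ) {ε : ℝ} (hε : 0 < ε) :
    ∃ y' : Fin d → ℝ, (∀ i, |y' i - y i| < ε) ∧
      ∀ x, (∀ i, F i x = y' i) → ∀ c : Fin d → ℝ, ∃ v, ∀ i, fderiv ℝ (F i) x v = c i := by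
  induction d with
  | zero => exact ⟨y, fun i => i.elim0, fun x _ c => ⟨0, fun i => i.elim0⟩⟩
  | succ d ih =>
    obtain ⟨z, hz, hreg⟩ := ih (by omega) (fun i => hF i.succ) (fun i => y i.succ)
    let g : E → Fin d → ℝ := fun x i => F i.succ x - z i
    have hg : ContDiff ℝ ∞ g := contDiff_pi.2 fun i => (hF i.succ).sub contDiff_const
    have hdg : ∀ x v i, fderiv ℝ g x v i = fderiv ℝ (F i.succ) x v := by
      intro x v i
      rw [(hasFDerivAt_pi_sub_const (fun i => hF i.succ) z x).fderiv]
      rfl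
    have hnull := (scalarSard (finrank ℝ E - d)).volume_image_levelSet (E := E)
      (by rw [finrank_fin_fun]; omega) isOpen_univ (fun x _ => (hF 0).contDiffAt)
      (fun x _ => hg.contDiffAt)
    obtain ⟨t, ht, hcrit⟩ : ∃ t ∈ Metric.ball (y 0) ε, t ∉ F 0 '' {x ∈ univ | g x = 0 ∧
        Function.Surjective (fderiv ℝ g x) ∧
          ∀ v, fderiv ℝ g x v = 0 → fderiv ℝ (F 0) x v = 0} := by
      by_contra! h
      exact (Metric.measure_ball_pos volume (y 0) hε).ne' (measure_mono_null h hnull)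
    refine ⟨Fin.cons t z, Fin.cases (by simpa [Real.dist_eq] using ht) (by simpa using hz),
      fun x hx c => ?_⟩
    have hx0 : F 0 x = t := by simpa using hx 0
    have hxs : ∀ i, F i.succ x = z i := fun i => by simpa using hx i.succ
    have hsolve : ∀ c : Fin d → ℝ, ∃ v, ∀ i, fderiv ℝ (F i.succ) x v = c i := hreg x hxs
    obtain ⟨w, hw, hw0⟩ : ∃ w, fderiv ℝ g x w = 0 ∧ fderiv ℝ (F 0) x w ≠ 0 := by
      by_contra! h
      refine hcrit ⟨x, ⟨mem_univ x, funext fun i => sub_eq_zero.2 (hxs i), fun c => ?_, h⟩, hx0⟩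
      obtain ⟨v, hv⟩ := hsolve c
      exact ⟨v, funext fun i => (hdg x v i).trans (hv i)⟩
    obtain ⟨v, hv⟩ := hsolve (Fin.tail c)
    refine ⟨v + ((c 0 - fderiv ℝ (F 0) x v) / fderiv ℝ (F 0) x w) • w, Fin.cases ?_ fun i => ?_⟩
    · rw [map_add, map_smul, smul_eq_mul, div_mul_cancel₀ _ hw0, add_sub_cancel]
    · rw [map_add, map_smul, hv i, ← hdg x w i, hw]
      simp [Fin.tail]

/-- An identification of `ℝᵈ × ℝⁿ⁻ᵈ` with `ℝⁿ` that puts the first factor in the last `d`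
coordinates, as the slices in `IsSmoothSubmanifold` require. -/
lemma exists_prod_equiv_euclideanSpace {n d : ℕ} (hdn : d ≤ n) :
    ∃ e : ((Fin d → ℝ) × (Fin (n - d) → ℝ)) ≃L[ℝ] EuclideanSpace ℝ (Fin n),
      ∀ p, (∀ j : Fin n, n - d ≤ (j : ℕ) → e p j = 0) ↔ p.1 = 0 := by
  let L : ((Fin d → ℝ) × (Fin (n - d) → ℝ)) →ₗ[ℝ] EuclideanSpace ℝ (Fin n) :=
    { toFun := fun p => WithLp.toLp 2 fun j =>
        if h : (j : ℕ) < n - d then p.2 ⟨j, h⟩ else p.1 ⟨j - (n - d), by omega⟩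
      map_add' := fun p q => by ext j; by_cases h : (j : ℕ) < n - d <;> simp [h]
      map_smul' := fun c p => by ext j; by_cases h : (j : ℕ) < n - d <;> simp [h] }
  have hL2 : ∀ p (i : Fin (n - d)), L p ⟨i, by omega⟩ = p.2 i := fun p i => by simp [L]
  have hL1 : ∀ p (i : Fin d), L p ⟨n - d + i, by omega⟩ = p.1 i := fun p i => by simp [L]
  have hinj : Function.Injective L := by
    rw [← LinearMap.ker_eq_bot, LinearMap.ker_eq_bot']
    intro p hp
    refine Prod.ext (funext fun i => ?_) (funext fun i => ?_)
    · rw [← hL1, hp]; rfl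
    · rw [← hL2, hp]; rfl
  refine ⟨(L.linearEquivOfInjective hinj (by simp; omega)).toContinuousLinearEquiv, fun p => ?_⟩
  change (∀ j : Fin n, n - d ≤ (j : ℕ) → L p j = 0) ↔ _
  constructor
  · intro h
    funext i
    rw [← hL1]
    exact h _ (by simp)
  · intro h j hj
    simp [L, not_lt.2 hj, h]

lemma isSmoothSubmanifold_of_submersion {n d : ℕ} (hdn : d ≤ n)
    {M : Set (EuclideanSpace ℝ (Fin n))} {g : EuclideanSpace ℝ (Fin n) → Fin d → ℝ}
    (hg : ContDiff ℝ ∞ g) (hM : ∀ x, x ∈ M ↔ g x = 0)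
    (hsurj : ∀ x ∈ M, Function.Surjective (fderiv ℝ g x)) : IsSmoothSubmanifold (n - d) M := by
  intro m hm
  obtain ⟨e, he⟩ := exists_prod_equiv_euclideanSpace hdn
  obtain ⟨Φ, hmΦ, -, hΦg, hΦ, hΦs⟩ := exists_chart_of_submersion (H := Fin (n - d) → ℝ)
    isOpen_univ (fun x _ => hg.contDiffAt) (mem_univ m) (hsurj m hm) (by simp; omega)
  refine ⟨Nat.sub_le n d, Φ.transHomeomorph e.toHomeomorph, hmΦ, e.contDiff.comp_contDiffOn hΦ,
    hΦs.comp e.symm.contDiff.contDiffOn fun z hz => hz, fun θ _ => ?_⟩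
  rw [hM, ← hΦg]
  exact (he (Φ θ)).symm

end RegularValues

/-! ### The zero locus of the loss -/

lemma squaredLoss_eq_zero_iff {n p d : ℕ}
    (f : EuclideanSpace ℝ (Fin n) → EuclideanSpace ℝ (Fin p) → ℝ)
    (x : Fin d → EuclideanSpace ℝ (Fin p)) (y : EuclideanSpace ℝ (Fin d))
    (θ : EuclideanSpace ℝ (Fin n)) :
    squaredLoss f x y θ = 0 ↔ ∀ i, dataResidual f x y i θ = 0 := by
  simp [squaredLoss, Finset.sum_eq_zero_iff_of_nonneg fun _ _ => sq_nonneg _]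

theorem mainTheorem1 {n p d : ℕ} (hdn : d < n)
    (f : EuclideanSpace ℝ (Fin n) → EuclideanSpace ℝ (Fin p) → ℝ)
    (x : Fin d → EuclideanSpace ℝ (Fin p)) (y : EuclideanSpace ℝ (Fin d))
    (hf : ∀ i, ContDiff ℝ ∞ (dataResidual f x y i))
    (ε : ℝ) (hε : 0 < ε) :
    ∃ y' : EuclideanSpace ℝ (Fin d), ‖y' - y‖ < ε ∧
      IsSmoothSubmanifold (n - d) (squaredLoss f x y' ⁻¹' {0}) := by
  -- Smoothness of the residuals does not depend on the labels.
  have hF : ∀ i, ContDiff ℝ ∞ fun θ => f θ (x i) := fun i => by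
    simpa [dataResidual] using (hf i).add (contDiff_const (c := y i))
  -- A sup-norm ball of radius `δ` around `y` lies in the Euclidean ball of radius `ε`.
  have hopen : IsOpen {c : Fin d → ℝ | ‖WithLp.toLp 2 c - y‖ < ε} :=
    isOpen_lt (by fun_prop) continuous_const
  obtain ⟨δ, hδ, hball⟩ := Metric.isOpen_iff.1 hopen (fun i => y i) (by simpa using hε)
  obtain ⟨y', hy', hreg⟩ := exists_regular_value_near (by simpa using hdn.le) hF (fun i => y i) hδ
  refine ⟨WithLp.toLp 2 y', hball ?_, ?_⟩
  · rw [Metric.mem_ball, dist_pi_lt_iff hδ]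
    exact hy'
  have hM : ∀ θ, θ ∈ squaredLoss f x (WithLp.toLp 2 y') ⁻¹' {0} ↔ ∀ i, f θ (x i) = y' i :=
    fun θ => (squaredLoss_eq_zero_iff f x _ θ).trans (forall_congr' fun i => sub_eq_zero)
  refine isSmoothSubmanifold_of_submersion hdn.le (g := fun θ i => f θ (x i) - y' i)
    (contDiff_pi.2 fun i => (hF i).sub contDiff_const)
    (fun θ => (hM θ).trans (by simp [funext_iff, sub_eq_zero])) fun θ hθ c => ?_
  obtain ⟨v, hv⟩ := hreg θ ((hM θ).1 hθ) c
  refine ⟨v, ?_⟩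
  rw [(hasFDerivAt_pi_sub_const hF y' θ).fderiv]
  exact funext hv
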